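/- Let $K$ be a field, $X$ and $Q$ sets, $K[X^*]$ the algebra of noncommutative polynomials, $R\subseteq K[X^*]$, and $F:Q\to K[X^*]$ a map. Let $\mathbf B$ be the one-object $K$-category whose arrows are the classes $[p]$ in $K[X^*]/{=_R}$, where $=_R$ is the congruence generated by $R$ (arrows are composed in the order in which they are written). Let $\mathbf A$ be either a category with one object $A$ generated by arrows $Q$, or a $K$-category with one object $A$ generated by arrows $Q$. Let $F':\mathbf A\to\mathbf B$ be a functor ($K$-functor, in the second case) with $F'(q)=[Fq]$ for $q\in Q$, and $M:\mathbf A\to K\text{-}\mathsf{Mod}$ a functor ($K$-functor) with $M(A)=K$ that sends every $q\in Q$ to the identity. Fix a well-ordering $>$ of $X^*$ compatible with concatenation on both sides; $\mathtt{LT}(r)$ is the greatest word occurring in $r\neq0$. Consider systems $\mathcal S$ of untagged polynomials $r\in K[X^*]$ and tagged polynomials $A|r$, $r\in K[X^*]$. If a nonzero untagged $r\in\mathcal S$ has leading coefficient $c$, and $u\,\mathtt{LT}(r)\,v$ ($u,v\in X^*$) occurs in $f$ with coefficient $k\ne0$, then $f\to_{\mathcal S} f-\frac kc\,urv$ and $A|f\to_{\mathcal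 S}A|(f-\frac kc\,urv)$. If a nonzero tagged $A|r\in\mathcal S$ has leading coefficient $c$, and $\mathtt{LT}(r)\,v$ ($v\in X^*$) occurs in $f$ with coefficient $k\neq0$, then $A|f\to_{\mathcal S}A|(f-\frac kc\,rv)$. The system generates congruences: on untagged polynomials, modulo the span of all $prq$ with $r\in\mathcal S$ untagged and $p,q\in K[X^*]$; on tagged polynomials, modulo the span of all $A|prq$ with $r\in\mathcal S$ untagged and all $A|rq$ with $A|r\in\mathcal S$. A Gröbner basis of $\mathcal S$ is a system $\mathcal G$ that generates the same congruences as $\mathcal S$ and for which $\to_{\mathcal G}$ is complete (Noetherian and confluent) on untagged and on tagged polynomials. Let $\mathcal G$ be a Gröbner basis of $\mathcal S=(R,\{A|Fq-A|1: q\in Q\})$. Write $\mathtt{IRR}$ for the set of tagged polynomials $A|p$ irreducible under $\to_{\mathcal G}$, and $\mathtt{irr}(A|p)$ for the unique irreducible result of repeated reduction of $A|p$. Then $\mathtt{IRR}$ is a $K$-module spanned by the irreducible tagged words, and the left Kan extension $(E,\varepsilon)$ of $M$ along $F'$ (universal among pairs of a $K$-functor $E:\mathbf B\to K\text{-}\mathsf{Mod}$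 and a natural transformation $\varepsilon:M\to E\circ F'$) is given by $$E(B)=\mathtt{IRR},\qquad E([b]):A|p\mapsto\mathtt{irr}(A|pb)\quad(b\in K[X^*]),\qquad \varepsilon_A(1)=\mathtt{irr}(A|1),$$ where $B$ is the object of $\mathbf B$. Moreover $\mathtt{irr}(A|1)=A|1$ unless $E(B)=0$. -/

import Mathlib

open CategoryTheory

universe u v w

namespace KanGroebner

/-! ### Noncommutative polynomials, tagged systems and reduction -/

/-- The algebra `K[X^*]` of noncommutative polynomials: the arrows of the free `K`-category on the
graph with one object and set of arrows `X`, multiplication being concatenation of paths. -/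
abbrev Poly (K X : Type u) [Field K] : Type u := MonoidAlgebra K (FreeMonoid X)

/-- A word, as a polynomial. -/
noncomputable abbrev word (K : Type u) {X : Type u} [Field K] (m : FreeMonoid X) : Poly K X :=
  MonoidAlgebra.single m 1

/-- An admissible well-ordering of the words. -/
structure Admissible {X : Type u} (lt : FreeMonoid X → FreeMonoid X → Prop) : Prop where
  wellOrder : IsWellOrder (FreeMonoid X) lt
  mul_mul : ∀ a b m n, lt m n → lt (a * m * b) (a * n * b)

/-- A set of mixed polynomials: untagged polynomials `p` and tagged polynomials `A|p`.
As there is only one tag, `A|p` is recorded by `p`. -/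
structure TaggedSystem (K X : Type u) [Field K] where
  untagged : Set (Poly K X)
  tagged : Set (Poly K X)

variable {K X : Type u} [Field K]

/-- `m` is the leading term of `r`: the greatest word occurring in `r`. -/
def IsLeadingWord (lt : FreeMonoid X → FreeMonoid X → Prop) (r : Poly K X)
    (m : FreeMonoid X) : Prop :=
  r.coeff m ≠ 0 ∧ ∀ n, r.coeff n ≠ 0 → n ≠ m → lt n m

/-- One-step reduction of untagged polynomials: if `u LT(r) v` occurs in `f` with coefficient `k`,
then `f` reduces to `f - k u r v` (with `r` scaled to be monic). -/
def UntaggedRed (lt : FreeMonoid X → FreeMonoid X → Prop) (S : TaggedSystem K X)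
    (f g : Poly K X) : Prop :=
  ∃ r ∈ S.untagged, ∃ m, IsLeadingWord lt r m ∧ ∃ a b,
    f.coeff (a * m * b) ≠ 0 ∧
      g = f - (f.coeff (a * m * b) / r.coeff m) • (word K a * r * word K b)

/-- One-step reduction `A|f → A|g` of tagged polynomials: an untagged `r` acts through the multiples
`A|a r b`, a tagged `A|r` only through the multiples `A|r b`. -/
def TaggedRed (lt : FreeMonoid X → FreeMonoid X → Prop) (S : TaggedSystem K X)
    (f g : Poly K X) : Prop :=
  UntaggedRed lt S f g ∨
  ∃ r ∈ S.tagged, ∃ m, IsLeadingWord lt r m ∧ ∃ b,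
    f.coeff (m * b) ≠ 0 ∧ g = f - (f.coeff (m * b) / r.coeff m) • (r * word K b)

/-- A complete relation: Noetherian and confluent. -/
def IsComplete {T : Type*} (red : T → T → Prop) : Prop :=
  WellFounded (fun g f => red f g) ∧
  ∀ f g h, Relation.ReflTransGen red f g → Relation.ReflTransGen red f h →
    ∃ k, Relation.ReflTransGen red g k ∧ Relation.ReflTransGen red h k

/-- The congruence generated by the system on untagged polynomials. -/
def UntaggedCongr (S : TaggedSystem K X) (f h : Poly K X) : Prop :=
  f - h ∈ Submodule.span K {x | ∃ r ∈ S.untagged, ∃ p q, x = p * r * q}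

/-- The congruence generated by the system on tagged polynomials. -/
def TaggedCongr (S : TaggedSystem K X) (f h : Poly K X) : Prop :=
  f - h ∈ Submodule.span K
    ({x | ∃ r ∈ S.untagged, ∃ p q, x = p * r * q} ∪ {x | ∃ r ∈ S.tagged, ∃ q, x = r * q})

/-- `G` is a Gröbner basis for `S`: it generates the same congruences, and its reduction relation is
complete (on untagged and on tagged polynomials). -/
structure IsGroebnerBasis (lt : FreeMonoid X → FreeMonoid X → Prop)
    (S G : TaggedSystem K X) : Prop where
  untaggedCongr_iff : ∀ f h, UntaggedCongr G f h ↔ UntaggedCongr S f h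
  taggedCongr_iff : ∀ f h, TaggedCongr G f h ↔ TaggedCongr S f h
  untagged_complete : IsComplete (UntaggedRed lt G)
  tagged_complete : IsComplete (TaggedRed lt G)

/-- The `K`-module `IRR` of irreducible elements `A|f`: those to which no reduction applies. -/
def IRR (lt : FreeMonoid X → FreeMonoid X → Prop) (G : TaggedSystem K X) :
    Submodule K (Poly K X) where
  carrier := {f | ∀ g, ¬ TaggedRed lt G f g}
  zero_mem' := by
    rintro g (⟨r, -, m, -, a, b, h, -⟩ | ⟨r, -, m, -, b, h, -⟩) <;> exact h (by simp)
  add_mem' := by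
    rintro f₁ f₂ h₁ h₂ g (⟨r, hr, m, hm, a, b, h, -⟩ | ⟨r, hr, m, hm, b, h, -⟩)
    · by_cases h0 : f₁.coeff (a * m * b) = 0
      · exact h₂ _ (Or.inl ⟨r, hr, m, hm, a, b, fun h' => h (by simp [h0, h']), rfl⟩)
      · exact h₁ _ (Or.inl ⟨r, hr, m, hm, a, b, h0, rfl⟩)
    · by_cases h0 : f₁.coeff (m * b) = 0
      · exact h₂ _ (Or.inr ⟨r, hr, m, hm, b, fun h' => h (by simp [h0, h']), rfl⟩)
      · exact h₁ _ (Or.inr ⟨r, hr, m, hm, b, h0, rfl⟩)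
  smul_mem' := by
    rintro c f hf g (⟨r, hr, m, hm, a, b, h, -⟩ | ⟨r, hr, m, hm, b, h, -⟩)
    · exact hf _ (Or.inl ⟨r, hr, m, hm, a, b, fun h' => h (by simp [h']), rfl⟩)
    · exact hf _ (Or.inr ⟨r, hr, m, hm, b, fun h' => h (by simp [h']), rfl⟩)

/-- `A|g` is an irreducible result of repeated reduction of `A|f`. -/
def IsNormalForm (lt : FreeMonoid X → FreeMonoid X → Prop) (G : TaggedSystem K X)
    (f g : Poly K X) : Prop :=
  Relation.ReflTransGen (TaggedRed lt G) f g ∧ g ∈ IRR lt G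

/-- The system `(R, {A|Fq - A|1 : q ∈ Q})`. -/
def kanSystem {Q : Type w} (R : Set (Poly K X)) (F : Q → Poly K X) : TaggedSystem K X where
  untagged := R
  tagged := Set.range fun q => F q - 1

/-- The factor algebra `K[X^*]/=_R`: the arrows of the `K`-category with one object presented by
`R`. -/
abbrev FactorAlgebra (R : Set (Poly K X)) : Type u :=
  RingQuot fun p q : Poly K X => p ∈ R ∧ q = 0

/-- The class `[p]_R`. -/
noncomputable abbrev cls (R : Set (Poly K X)) : Poly K X →ₐ[K] FactorAlgebra R :=
  RingQuot.mkAlgHom K _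

/-! ### Categories with one object -/

/-- The category with one object and set of arrows `N`. Arrows compose in the order in which
they are written: `m` followed by `n` is `m * n`. -/
@[nolint unusedArguments]
def OneObj (_ : Type v) : Type := Unit

/-- The object. -/
def OneObj.pt (N : Type v) : OneObj N := ()

instance (N : Type v) [Monoid N] : Category.{v} (OneObj N) where
  Hom _ _ := N
  id _ := (1 : N)
  comp m n := (HMul.hMul (α := N) (β := N) m n : N)
  id_comp := fun m => one_mul (M := N) m
  comp_id := fun m => mul_one (M := N) m
  assoc := fun m n k => mul_assoc (G := N) m n k

instance (N : Type v) [Ring N] : Preadditive (OneObj N) where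
  homGroup _ _ := inferInstanceAs (AddCommGroup N)
  add_comp := fun _ _ _ f f' g => add_mul (R := N) f f' g
  comp_add := fun _ _ _ f g g' => mul_add (R := N) f g g'

/-- For a `K`-algebra `N` this is a `K`-category. -/
instance (N : Type v) [Ring N] [Algebra K N] : Linear K (OneObj N) where
  homModule _ _ := inferInstanceAs (Module K N)
  smul_comp := fun _ _ _ k f g => smul_mul_assoc (α := K) (β := N) k f g
  comp_smul := fun _ _ _ f k g => mul_smul_comm (s := k) (x := (f : N)) (y := (g : N))

/-- The functor between one-object categories given by a homomorphism. -/
def OneObj.functor {N : Type v} {N' : Type w} [Monoid N] [Monoid N'] (φ : N →* N') :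
    OneObj N ⥤ OneObj N' where
  obj _ := OneObj.pt N'
  map n := φ n
  map_id _ := φ.map_one
  map_comp := fun m n => φ.map_mul m n

/-- The functor to `K`-modules that sends the object to `V` and the arrow `n` to the endomorphism
`ρ n`; the opposite algebra appears because `n` followed by `n'` is written `n * n'`. -/
def OneObj.action {N : Type v} [Monoid N] {V : Type u} [AddCommGroup V] [Module K V]
    (ρ : N →* (Module.End K V)ᵐᵒᵖ) : OneObj N ⥤ ModuleCat.{u} K where
  obj _ := ModuleCat.of K V
  map n := ModuleCat.ofHom (ρ n).unop
  map_id _ := by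
    change ModuleCat.ofHom (ρ 1).unop = _
    rw [map_one]; rfl
  map_comp := fun m n => by
    change ModuleCat.ofHom (ρ (HMul.hMul (α := N) (β := N) m n)).unop = _
    rw [map_mul]; rfl

/-! ### Left Kan extensions for `K`-categories -/

/-- `(E, ε)` is the left Kan extension of `M` along `F`, with values in `K`-modules: `E` is a
`K`-functor, and every `(E', ε')` with a `K`-functor `E'` factors uniquely through it. -/
structure IsLeftKanExtension {A : Type*} [Category A] {B : Type*} [Category B]
    [Preadditive B] [Linear K B] (F : A ⥤ B) (M : A ⥤ ModuleCat.{u} K)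
    (E : B ⥤ ModuleCat.{u} K) (ε : M ⟶ F ⋙ E) : Prop where
  additive : E.Additive
  linear : E.Linear K
  existsUnique : ∀ (E' : B ⥤ ModuleCat.{u} K), E'.Additive → E'.Linear K →
    ∀ ε' : M ⟶ F ⋙ E', ∃! α : E ⟶ E', ε' = ε ≫ Functor.whiskerLeft F α

/-- There is a natural transformation `ε` with `ε_A(1) = e` which makes `(E, ε)` the left Kan
extension of the action of `N` on `K` by `χ`, along `φ`; here `E` is the action on `V` by `ρ`. -/
def IsKanExtensionWith {N : Type w} [Monoid N] {B : Type u} [Ring B] [Algebra K B]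
    {V : Type u} [AddCommGroup V] [Module K V]
    (χ : N →* (Module.End K K)ᵐᵒᵖ) (φ : N →* B) (ρ : B →ₐ[K] (Module.End K V)ᵐᵒᵖ) (e : V) : Prop :=
  ∃ ε : OneObj.action χ ⟶ OneObj.functor φ ⋙ OneObj.action (ρ : B →* (Module.End K V)ᵐᵒᵖ),
    (ε.app (OneObj.pt N)).hom (1 : K) = e ∧
    IsLeftKanExtension (OneObj.functor φ) (OneObj.action χ)
      (OneObj.action (ρ : B →* (Module.End K V)ᵐᵒᵖ)) ε

end KanGroebner

namespace KanGroebner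

open Relation

variable {K X : Type u} [Field K]

/-! ### The congruence as equality of normal forms -/

/-! Let `J` be the right ideal generated by the two-sided ideal of `R` and the elements `F q - 1`;
it is the `taggedSpan` of the Kan system. A transformation from `M` to a `K`-functor `E'` amounts to
a vector fixed by every `[F q]`, and its orbit map kills `J`. So the Kan extension is the right
module `K[X^*]/J` with the class of `1` as universal vector.

Completeness of reduction makes `IRR` a linear complement of `J` (`isCompl_IRR_taggedSpan`), so
`IRR` models this quotient and normal form is projection along `J`. The crux is
`taggedSpan_le_invariantSubmodule`: adding an element of `J` never changes normal forms.
`isKanExtensionWith_of_action` then gives the universal property for any complement of `J`. -/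

/-- The submodule by which the congruence on tagged polynomials is taken. -/
noncomputable def taggedSpan (S : TaggedSystem K X) : Submodule K (Poly K X) :=
  Submodule.span K
    ({x | ∃ r ∈ S.untagged, ∃ p q, x = p * r * q} ∪ {x | ∃ r ∈ S.tagged, ∃ q, x = r * q})

theorem mul_mul_mem_taggedSpan {S : TaggedSystem K X} {r : Poly K X} (hr : r ∈ S.untagged)
    (p q : Poly K X) : p * r * q ∈ taggedSpan S :=
  Submodule.subset_span (Or.inl ⟨r, hr, p, q, rfl⟩)

theorem mul_mem_taggedSpan {S : TaggedSystem K X} {r : Poly K X} (hr : r ∈ S.tagged)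
    (q : Poly K X) : r * q ∈ taggedSpan S :=
  Submodule.subset_span (Or.inr ⟨r, hr, q, rfl⟩)

theorem taggedSpan_mul_right (S : TaggedSystem K X) {x : Poly K X} (hx : x ∈ taggedSpan S)
    (b : Poly K X) : x * b ∈ taggedSpan S := by
  have h : taggedSpan S ≤ (taggedSpan S).comap (LinearMap.mulRight K b) := by
    refine Submodule.span_le.2 ?_
    rintro _ (⟨r, hr, p, q, rfl⟩ | ⟨r, hr, q, rfl⟩)
    · simpa [mul_assoc] using mul_mul_mem_taggedSpan hr p (q * b)
    · simpa [mul_assoc] using mul_mem_taggedSpan hr (q * b)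
  exact h hx

/-- A nonzero polynomial has a leading word. -/
theorem exists_isLeadingWord {lt : FreeMonoid X → FreeMonoid X → Prop}
    (hlt : Admissible lt) {r : Poly K X} (hr : r ≠ 0) : ∃ m, IsLeadingWord lt r m := by
  have := hlt.wellOrder
  have hne : r.coeff.support.Nonempty := by
    rw [Finsupp.support_nonempty_iff]
    simpa using hr
  classical
  let _ : LinearOrder (FreeMonoid X) := linearOrderOfSTO lt
  refine ⟨r.coeff.support.max' hne, Finsupp.mem_support_iff.1 (Finset.max'_mem _ hne), ?_⟩
  intro n hn hne'
  exact (Finset.le_max' _ n (Finsupp.mem_support_iff.2 hn)).resolve_left hne'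

/-- The empty word is the least word. -/
theorem Admissible.not_lt_one {lt : FreeMonoid X → FreeMonoid X → Prop}
    (hlt : Admissible lt) (m : FreeMonoid X) : ¬ lt m 1 := by
  intro h
  have := hlt.wellOrder
  have hwf : WellFounded lt := IsWellFounded.wf
  -- A word below `1` would have powers forming an infinite descending chain.
  have step : ∀ n : ℕ, lt (m ^ (n + 1)) (m ^ n) := fun n => by
    have := hlt.mul_mul (m ^ n) 1 m 1 h
    simpa [pow_succ] using this
  exact (RelEmbedding.wellFounded_iff_isEmpty.1 hwf).elim
    (RelEmbedding.natGT (fun n => m ^ n) step)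

theorem coeff_word_mul_mul_word (r : Poly K X) (a m b : FreeMonoid X) :
    (word K a * r * word K b).coeff (a * m * b) = r.coeff m := by
  simp

theorem TaggedRed.sub_mem {lt : FreeMonoid X → FreeMonoid X → Prop} {S : TaggedSystem K X}
    {f g : Poly K X} (h : TaggedRed lt S f g) : f - g ∈ taggedSpan S := by
  rcases h with ⟨r, hr, m, -, a, b, -, rfl⟩ | ⟨r, hr, m, -, b, -, rfl⟩
  · rw [sub_sub_cancel]
    exact Submodule.smul_mem _ _ (mul_mul_mem_taggedSpan hr _ _)
  · rw [sub_sub_cancel]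
    exact Submodule.smul_mem _ _ (mul_mem_taggedSpan hr _)

theorem sub_mem_taggedSpan_of_reflTransGen {lt : FreeMonoid X → FreeMonoid X → Prop}
    {S : TaggedSystem K X} {f g : Poly K X} (h : ReflTransGen (TaggedRed lt S) f g) :
    f - g ∈ taggedSpan S := by
  induction h with
  | refl => simp
  | tail _ h ih => simpa using add_mem ih h.sub_mem

/-- Two polynomials with the same normal forms. -/
def SameNormalForms (lt : FreeMonoid X → FreeMonoid X → Prop) (G : TaggedSystem K X)
    (f g : Poly K X) : Prop :=
  ∀ z, IsNormalForm lt G f z ↔ IsNormalForm lt G g z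

theorem eq_of_reflTransGen_of_mem_IRR {lt : FreeMonoid X → FreeMonoid X → Prop}
    {G : TaggedSystem K X} {f g : Poly K X} (hf : f ∈ IRR lt G)
    (h : ReflTransGen (TaggedRed lt G) f g) : g = f := by
  rcases h.cases_head with rfl | ⟨c, hc, -⟩
  · rfl
  · exact (hf c hc).elim

/-- Confluence joins `g` to any normal form `z` of `f`; as `z` is irreducible, the join is `z`
itself. -/
theorem sameNormalForms_of_reflTransGen {lt : FreeMonoid X → FreeMonoid X → Prop}
    {G : TaggedSystem K X} (hG : IsComplete (TaggedRed lt G)) {f g : Poly K X}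
    (h : ReflTransGen (TaggedRed lt G) f g) : SameNormalForms lt G f g := by
  refine fun z => ⟨fun hz => ⟨?_, hz.2⟩, fun hz => ⟨h.trans hz.1, hz.2⟩⟩
  obtain ⟨k, hgk, hzk⟩ := hG.2 f g z h hz.1
  rwa [eq_of_reflTransGen_of_mem_IRR hz.2 hzk] at hgk

/-- A multiple of a polynomial that can be used to eliminate a word does not change the
normal forms. -/
theorem sameNormalForms_add_smul {lt : FreeMonoid X → FreeMonoid X → Prop}
    {G : TaggedSystem K X} (hG : IsComplete (TaggedRed lt G)) {x : Poly K X} {w : FreeMonoid X}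
    (hx : x.coeff w ≠ 0)
    (hred : ∀ f : Poly K X, f.coeff w ≠ 0 → TaggedRed lt G f (f - (f.coeff w / x.coeff w) • x))
    (k : K) (f : Poly K X) : SameNormalForms lt G f (f + k • x) := by
  have key : ∀ f : Poly K X, SameNormalForms lt G f (f - (f.coeff w / x.coeff w) • x) := by
    intro f
    by_cases hf : f.coeff w = 0
    · simp [hf, SameNormalForms]
    · exact sameNormalForms_of_reflTransGen hG (.single (hred f hf))
  -- Eliminating `w` by means of `x` sends `f` and `f + k • x` to the same polynomial.
  have h : f + k • x - ((f + k • x).coeff w / x.coeff w) • x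
      = f - (f.coeff w / x.coeff w) • x := by
    have : (f + k • x).coeff w / x.coeff w = f.coeff w / x.coeff w + k := by
      simp [add_div, hx]
    rw [this, add_smul]
    abel
  intro z
  have h₂ := key (f + k • x) z
  rw [h] at h₂
  exact (key f z).trans h₂.symm

/-- The polynomials whose multiples can be added without changing the normal forms. -/
noncomputable def invariantSubmodule (lt : FreeMonoid X → FreeMonoid X → Prop) (G : TaggedSystem K X) :
    Submodule K (Poly K X) where
  -- Quantifying over all `k` and all `f` makes closure under sums and scalars a matter of chaining
  -- equivalences.
  carrier := {x | ∀ (k : K) f, SameNormalForms lt G f (f + k • x)}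
  zero_mem' := by simp [SameNormalForms]
  add_mem' := by
    intro x y hx hy k f z
    rw [smul_add, ← add_assoc]
    exact (hx k f z).trans (hy k _ z)
  smul_mem' := by
    intro c x hx k f z
    rw [smul_smul]
    exact hx _ f z

/-- By linearity the cofactors may be taken to be words; then the multiple eliminates the word built
from the leading word of `r`, where its coefficient is that of `r` and hence nonzero. -/
theorem taggedSpan_le_invariantSubmodule {lt : FreeMonoid X → FreeMonoid X → Prop}
    (hlt : Admissible lt) {G : TaggedSystem K X} (hG : IsComplete (TaggedRed lt G)) :
    taggedSpan G ≤ invariantSubmodule lt G := by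
  refine Submodule.span_le.2 ?_
  rintro _ (⟨r, hr, p, q, rfl⟩ | ⟨r, hr, q, rfl⟩)
  · rcases eq_or_ne r 0 with rfl | hr0
    · simp
    obtain ⟨m, hm⟩ := exists_isLeadingWord hlt hr0
    simp only [SetLike.mem_coe]
    induction p using MonoidAlgebra.induction_linear with
    | zero => simp
    | add p p' hp hp' => simpa [add_mul] using add_mem hp hp'
    | single a c =>
      have hac : MonoidAlgebra.single a c = c • word K a := by simp
      rw [hac, smul_mul_assoc, smul_mul_assoc]
      refine Submodule.smul_mem _ _ ?_
      induction q using MonoidAlgebra.induction_linear with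
      | zero => simp
      | add q q' hq hq' => simpa [mul_add] using add_mem hq hq'
      | single b d =>
        have hbd : MonoidAlgebra.single b d = d • word K b := by simp
        rw [hbd, mul_smul_comm]
        refine Submodule.smul_mem _ _ ?_
        have hcoeff := coeff_word_mul_mul_word r a m b
        refine sameNormalForms_add_smul hG (w := a * m * b) (by rw [hcoeff]; exact hm.1) ?_
        intro f hf
        rw [hcoeff]
        exact Or.inl ⟨r, hr, m, hm, a, b, hf, rfl⟩
  · rcases eq_or_ne r 0 with rfl | hr0
    · simp
    obtain ⟨m, hm⟩ := exists_isLeadingWord hlt hr0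
    simp only [SetLike.mem_coe]
    induction q using MonoidAlgebra.induction_linear with
    | zero => simp
    | add q q' hq hq' => simpa [mul_add] using add_mem hq hq'
    | single b d =>
      have hbd : MonoidAlgebra.single b d = d • word K b := by simp
      rw [hbd, mul_smul_comm]
      refine Submodule.smul_mem _ _ ?_
      have hcoeff : (r * word K b).coeff (m * b) = r.coeff m := by simp
      refine sameNormalForms_add_smul hG (w := m * b) (by rw [hcoeff]; exact hm.1) ?_
      intro f hf
      rw [hcoeff]
      exact Or.inr ⟨r, hr, m, hm, b, hf, rfl⟩

theorem exists_isNormalForm {lt : FreeMonoid X → FreeMonoid X → Prop} {G : TaggedSystem K X}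
    (hG : IsComplete (TaggedRed lt G)) (f : Poly K X) : ∃ g, IsNormalForm lt G f g := by
  induction f using hG.1.induction with
  | _ f ih =>
    by_cases hf : f ∈ IRR lt G
    · exact ⟨f, .refl, hf⟩
    · have : ∃ g, TaggedRed lt G f g := by
        by_contra! h
        exact hf h
      obtain ⟨g, hg⟩ := this
      obtain ⟨z, hz⟩ := ih g hg
      exact ⟨z, .head hg hz.1, hz.2⟩

theorem isNormalForm_iff {lt : FreeMonoid X → FreeMonoid X → Prop} (hlt : Admissible lt)
    {G : TaggedSystem K X} (hG : IsComplete (TaggedRed lt G)) {f g : Poly K X} :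
    IsNormalForm lt G f g ↔ g ∈ IRR lt G ∧ f - g ∈ taggedSpan G := by
  refine ⟨fun h => ⟨h.2, sub_mem_taggedSpan_of_reflTransGen h.1⟩, fun ⟨hg, h⟩ => ?_⟩
  -- Adding `f - g` to `g` gives `f`, so `f` inherits the normal form `g` of the irreducible `g`.
  have := taggedSpan_le_invariantSubmodule hlt hG h 1 g g
  rw [one_smul, add_sub_cancel] at this
  exact this.1 ⟨.refl, hg⟩

theorem isCompl_IRR_taggedSpan {lt : FreeMonoid X → FreeMonoid X → Prop} (hlt : Admissible lt)
    {G : TaggedSystem K X} (hG : IsComplete (TaggedRed lt G)) :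
    IsCompl (IRR lt G) (taggedSpan G) := by
  constructor
  · rw [Submodule.disjoint_def]
    intro f hf hfJ
    -- An irreducible `f` in the span has normal form `0`, yet it can only reduce to itself.
    have h : IsNormalForm lt G f 0 :=
      (isNormalForm_iff hlt hG).2 ⟨zero_mem _, by simpa using hfJ⟩
    exact (eq_of_reflTransGen_of_mem_IRR hf h.1).symm
  · rw [codisjoint_iff, eq_top_iff]
    intro f _
    obtain ⟨g, hg⟩ := exists_isNormalForm hG f
    have h := (isNormalForm_iff hlt hG).1 hg
    exact Submodule.mem_sup.2 ⟨g, h.1, f - g, h.2, by simp⟩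

/-- The irreducible polynomials are the combinations of irreducible words. -/
theorem IRR_eq_span (lt : FreeMonoid X → FreeMonoid X → Prop) (G : TaggedSystem K X) :
    IRR lt G = Submodule.span K {x | x ∈ IRR lt G ∧ ∃ m : FreeMonoid X, x = word K m} := by
  refine le_antisymm (fun f hf => ?_) (Submodule.span_le.2 fun x hx => hx.1)
  have hword : ∀ n, f.coeff n ≠ 0 → word K n ∈ IRR lt G := by
    rintro n hn g (⟨r, hr, m, hm, a, b, h, -⟩ | ⟨r, hr, m, hm, b, h, -⟩)
    · have : n = a * m * b := by
        by_contra hne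
        exact h (Finsupp.single_eq_of_ne (Ne.symm hne))
      exact hf _ (Or.inl ⟨r, hr, m, hm, a, b, this ▸ hn, rfl⟩)
    · have : n = m * b := by
        by_contra hne
        exact h (Finsupp.single_eq_of_ne (Ne.symm hne))
      exact hf _ (Or.inr ⟨r, hr, m, hm, b, this ▸ hn, rfl⟩)
  rw [← MonoidAlgebra.sum_coeff_single f]
  refine Submodule.sum_mem _ fun n hn => ?_
  have : MonoidAlgebra.single n (f.coeff n) = f.coeff n • word K n := by simp
  rw [this]
  exact Submodule.smul_mem _ _
    (Submodule.subset_span ⟨hword n (Finsupp.mem_support_iff.1 hn), n, rfl⟩)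

/-- If `A|1` is reducible, the system contains a nonzero constant. -/
theorem one_mem_IRR_or_one_mem_taggedSpan {lt : FreeMonoid X → FreeMonoid X → Prop}
    (hlt : Admissible lt) (G : TaggedSystem K X) : 1 ∈ IRR lt G ∨ 1 ∈ taggedSpan G := by
  by_contra! hcon
  -- A polynomial with leading word `1` is a nonzero constant, because no word lies below `1`.
  have hconst : ∀ r : Poly K X, IsLeadingWord lt r 1 → r ∈ taggedSpan G → False := by
    intro r hr hrG
    have hr1 : r = r.coeff 1 • (1 : Poly K X) := by
      ext n
      rcases eq_or_ne n 1 with rfl | hn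
      · simp
      · have : r.coeff n = 0 := by
          by_contra h
          exact hlt.not_lt_one n (hr.2 n h hn)
        simp [this, MonoidAlgebra.one_def, hn.symm]
    refine hcon.2 ?_
    rw [hr1] at hrG
    exact (Submodule.smul_mem_iff _ hr.1).1 hrG
  have hsupp : ∀ n, (1 : Poly K X).coeff n ≠ 0 → n = 1 := by
    intro n hn
    by_contra hne
    exact hn (Finsupp.single_eq_of_ne hne)
  have hmul : ∀ a b : FreeMonoid X, a * b = 1 → a = 1 ∧ b = 1 := fun a b h => by
    simpa [FreeMonoid.toList.injective.eq_iff' FreeMonoid.toList_one] using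
      congrArg FreeMonoid.toList h
  refine hcon.1 ?_
  rintro g (⟨r, hr, m, hm, a, b, h, -⟩ | ⟨r, hr, m, hm, b, h, -⟩)
  · obtain rfl := (hmul a m (hmul _ _ (hsupp _ h)).1).2
    exact hconst r hm (by simpa using mul_mul_mem_taggedSpan hr 1 1)
  · obtain rfl := (hmul m b (hsupp _ h)).1
    exact hconst r hm (by simpa using mul_mem_taggedSpan hr 1)

end KanGroebner

namespace KanGroebner

/-! ### The action on a complement of a right ideal -/

section QuotientAction

variable {K P : Type*} [Field K] [Ring P] [Algebra K P] {V J : Submodule K P}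

theorem projectionOnto_eq_of_sub_mem (h : IsCompl V J) {x y : P} (hxy : x - y ∈ J) :
    V.projectionOnto J h x = V.projectionOnto J h y := by
  rw [← sub_eq_zero, ← map_sub]
  exact (V.projectionOnto_apply_eq_zero_iff h).2 hxy

theorem sub_projectionOnto_mem (h : IsCompl V J) (x : P) :
    x - (V.projectionOnto J h x : P) ∈ J := by
  rw [← V.projectionOnto_apply_eq_zero_iff h, map_sub, V.projectionOnto_apply_left, sub_self]

/-- The first projection discards an element of `J`, which stays in `J` after right multiplication.
This makes the action multiplicative. -/
theorem projectionOnto_projectionOnto_mul (h : IsCompl V J) (hJ : ∀ x ∈ J, ∀ b, x * b ∈ J)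
    (x b : P) :
    V.projectionOnto J h ((V.projectionOnto J h x : P) * b) = V.projectionOnto J h (x * b) := by
  symm
  apply projectionOnto_eq_of_sub_mem h
  rw [← sub_mul]
  exact hJ _ (sub_projectionOnto_mem h x) b

/-- The right action of an algebra on a complement `V` of a right ideal `J`. -/
noncomputable def complementAction (h : IsCompl V J) (hJ : ∀ x ∈ J, ∀ b, x * b ∈ J) :
    P →ₐ[K] (Module.End K V)ᵐᵒᵖ :=
  AlgHom.ofLinearMap
    { toFun := fun b => MulOpposite.op
        (V.projectionOnto J h ∘ₗ LinearMap.mulRight K b ∘ₗ V.subtype)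
      map_add' := fun b c => by
        apply MulOpposite.unop_injective
        ext p
        simp [mul_add]
      map_smul' := fun k b => by
        apply MulOpposite.unop_injective
        ext p
        simp }
    (by
      apply MulOpposite.unop_injective
      ext p
      simp)
    (fun b c => by
      apply MulOpposite.unop_injective
      refine LinearMap.ext fun p => ?_
      change V.projectionOnto J h (p * (b * c))
        = V.projectionOnto J h ((V.projectionOnto J h (p * b) : P) * c)
      rw [projectionOnto_projectionOnto_mul h hJ, mul_assoc])

theorem complementAction_apply (h : IsCompl V J) (hJ : ∀ x ∈ J, ∀ b, x * b ∈ J) (b : P) (p : V) :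
    (complementAction h hJ b).unop p = V.projectionOnto J h (p * b) :=
  rfl

end QuotientAction

/-! ### The universal property -/

section UniversalProperty

variable {K X : Type u} [Field K] {Q : Type v} {R : Set (Poly K X)} {F : Q → Poly K X}
  {V : Submodule K (Poly K X)}

theorem cls_surjective (R : Set (Poly K X)) : Function.Surjective (cls R) :=
  RingQuot.mkAlgHom_surjective K _

theorem cls_eq_zero {r : Poly K X} (hr : r ∈ R) : cls R r = 0 := by
  rw [← map_zero (cls R)]
  exact RingQuot.mkAlgHom_rel K ⟨hr, rfl⟩

/-- The action of the factor algebra on a complement of the right ideal of the Kan system. -/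
theorem exists_factorAlgebra_action (h : IsCompl V (taggedSpan (kanSystem R F))) :
    ∃ ρ : FactorAlgebra R →ₐ[K] (Module.End K V)ᵐᵒᵖ,
      ∀ b p, (ρ (cls R b)).unop p = V.projectionOnto _ h (p * b) := by
  have hJ : ∀ x ∈ taggedSpan (kanSystem R F), ∀ b, x * b ∈ taggedSpan (kanSystem R F) :=
    fun _ hx b => taggedSpan_mul_right _ hx b
  refine ⟨RingQuot.liftAlgHom K ⟨complementAction h hJ, ?_⟩, fun b p => ?_⟩
  -- Elements of `R` act as zero because `p * r` lies in `J` for every left factor `p`.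
  · rintro r _ ⟨hr, rfl⟩
    apply MulOpposite.unop_injective
    refine LinearMap.ext fun p => ?_
    rw [complementAction_apply, complementAction_apply]
    apply projectionOnto_eq_of_sub_mem
    simpa using mul_mul_mem_taggedSpan (S := kanSystem R F) hr p 1
  · rw [RingQuot.liftAlgHom_mkAlgHom_apply, complementAction_apply]

/-- The elements of `N` that act on `e` through the character `χ` are closed under products. -/
theorem action_eq_smul_mul {N B V' : Type*} [Monoid N] [Ring B] [Algebra K B] [AddCommGroup V']
    [Module K V'] {χ : N →* (Module.End K K)ᵐᵒᵖ} {φ : N →* B}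
    {ρ : B →ₐ[K] (Module.End K V')ᵐᵒᵖ} {e : V'} {m n : N}
    (hm : (ρ (φ m)).unop e = (χ m).unop 1 • e) (hn : (ρ (φ n)).unop e = (χ n).unop 1 • e) :
    (ρ (φ (m * n))).unop e = (χ (m * n)).unop 1 • e := by
  -- An endomorphism of `K` is multiplication by its value at `1`.
  have h : (χ n).unop ((χ m).unop 1) = (χ m).unop 1 * (χ n).unop 1 := by
    conv_lhs => rw [← mul_one ((χ m).unop 1), ← smul_eq_mul, map_smul, smul_eq_mul]
  simp only [map_mul, MulOpposite.unop_mul, Module.End.mul_apply]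
  rw [hm, map_smul, hn, h, mul_smul]

/-! ### Functors on a one-object category as right modules -/

/-- The endomorphism by which a functor on a one-object category acts. -/
def endHom {B : Type u} [Ring B] [Algebra K B] (E : OneObj B ⥤ ModuleCat.{u} K) (b : B) :
    Module.End K (E.obj (OneObj.pt B)) :=
  (E.map (X := OneObj.pt B) (Y := OneObj.pt B) b).hom

section

variable {B : Type u} [Ring B] [Algebra K B] (E : OneObj B ⥤ ModuleCat.{u} K)

theorem endHom_one : endHom E (1 : B) = 1 :=
  congrArg ModuleCat.Hom.hom (E.map_id (OneObj.pt B))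

/-- The order reverses because arrows compose in writing order and endomorphisms from right to left.
-/
theorem endHom_mul (b c : B) : endHom E (b * c) = endHom E c * endHom E b :=
  congrArg ModuleCat.Hom.hom
    (E.map_comp (X := OneObj.pt B) (Y := OneObj.pt B) (Z := OneObj.pt B) b c)

theorem endHom_add [E.Additive] (b c : B) : endHom E (b + c) = endHom E b + endHom E c :=
  congrArg ModuleCat.Hom.hom
    (E.map_add (X := OneObj.pt B) (Y := OneObj.pt B) (f := b) (g := c))

theorem endHom_smul [E.Additive] [E.Linear K] (k : K) (b : B) :
    endHom E (k • b) = k • endHom E b :=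
  congrArg ModuleCat.Hom.hom
    (E.map_smul (X := OneObj.pt B) (Y := OneObj.pt B) (f := b) k)

/-- The orbit map of an element under the arrows of the target category. -/
def orbitMap [E.Additive] [E.Linear K] (e : E.obj (OneObj.pt B)) :
    B →ₗ[K] E.obj (OneObj.pt B) where
  toFun b := endHom E b e
  map_add' b c := by rw [endHom_add]; rfl
  map_smul' k b := by rw [endHom_smul]; rfl

theorem orbitMap_apply [E.Additive] [E.Linear K] (e : E.obj (OneObj.pt B)) (b : B) :
    orbitMap E e b = endHom E b e :=
  rfl

theorem orbitMap_mul [E.Additive] [E.Linear K] (e : E.obj (OneObj.pt B)) (b c : B) :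
    orbitMap E e (b * c) = endHom E c (orbitMap E e b) := by
  rw [orbitMap_apply, endHom_mul]
  rfl

end

/-- An element that is fixed by the classes `[Fq]` has an orbit map that vanishes on the right
ideal of the Kan system. -/
theorem orbitMap_cls_eq_zero (E : OneObj (FactorAlgebra R) ⥤ ModuleCat.{u} K) [E.Additive]
    [E.Linear K] (e : E.obj (OneObj.pt (FactorAlgebra R)))
    (he : ∀ q, endHom E (cls R (F q)) e = e) {x : Poly K X}
    (hx : x ∈ taggedSpan (kanSystem R F)) : orbitMap E e (cls R x) = 0 := by
  suffices h : taggedSpan (kanSystem R F) ≤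
      LinearMap.ker (orbitMap E e ∘ₗ (cls R).toLinearMap) from h hx
  refine Submodule.span_le.2 ?_
  rintro _ (⟨r, hr, p, q, rfl⟩ | ⟨_, ⟨q', rfl⟩, q, rfl⟩)
  · have : cls R r = 0 := cls_eq_zero hr
    simp [this]
  · have h1 : orbitMap E e (cls R (F q' - 1)) = 0 := by
      rw [map_sub, map_one, map_sub, orbitMap_apply, orbitMap_apply, he, endHom_one]
      exact sub_self e
    change orbitMap E e (cls R ((F q' - 1) * q)) = 0
    rw [map_mul, orbitMap_mul, h1, map_zero]

/-- Common core of the plain and the `K`-linear case: only `hnat`, the naturality of `ε`, depends on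
how `Q` generates `N`. -/
theorem isKanExtensionWith_of_action {N : Type w} [Monoid N]
    (h : IsCompl V (taggedSpan (kanSystem R F)))
    {ρ : FactorAlgebra R →ₐ[K] (Module.End K V)ᵐᵒᵖ}
    (hρ : ∀ b p, (ρ (cls R b)).unop p = V.projectionOnto _ h (p * b))
    {ι : Q → N} {χ : N →* (Module.End K K)ᵐᵒᵖ} (hχ : ∀ q, χ (ι q) = 1)
    {φ : N →* FactorAlgebra R} (hφ : ∀ q, φ (ι q) = cls R (F q))
    (hnat : ∀ n, (ρ (φ n)).unop (V.projectionOnto _ h 1)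
      = (χ n).unop 1 • V.projectionOnto _ h 1) :
    IsKanExtensionWith χ φ ρ (V.projectionOnto _ h 1) := by
  set e : V := V.projectionOnto _ h 1 with he
  have hJ : ∀ x ∈ taggedSpan (kanSystem R F), ∀ b, x * b ∈ taggedSpan (kanSystem R F) :=
    fun _ hx b => taggedSpan_mul_right _ hx b
  -- The vector `e` generates `V` under the action, which forces uniqueness of the factorization.
  have hgen : ∀ p : V, p = (ρ (cls R p)).unop e := by
    intro p
    rw [hρ, he, projectionOnto_projectionOnto_mul h hJ, one_mul, V.projectionOnto_apply_left]
  refine ⟨{ app := fun _ => ModuleCat.ofHom (LinearMap.toSpanSingleton K V e)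
            naturality := ?_ }, ?_, ?_, ?_, ?_⟩
  · intro _ _ n
    apply ModuleCat.hom_ext
    refine LinearMap.ext_ring ?_
    change (χ n).unop 1 • e = (ρ (φ n)).unop ((1 : K) • e)
    rw [one_smul, hnat]
  · exact one_smul K e
  · refine ⟨fun {_ _ b c} => ?_⟩
    apply ModuleCat.hom_ext
    exact congrArg MulOpposite.unop (map_add ρ b c)
  · refine ⟨fun {_ _} b k => ?_⟩
    apply ModuleCat.hom_ext
    exact congrArg MulOpposite.unop (map_smul ρ k b)
  · intro E' hadd hlin ε'
    let e' : E'.obj (OneObj.pt (FactorAlgebra R)) := (ε'.app (OneObj.pt N)).hom (1 : K)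
    have he' : ∀ q, endHom E' (cls R (F q)) e' = e' := by
      intro q
      have := congrArg (fun f => ModuleCat.Hom.hom f (1 : K))
        (ε'.naturality (X := OneObj.pt N) (Y := OneObj.pt N) (ι q))
      change (ε'.app (OneObj.pt N)).hom ((χ (ι q)).unop (1 : K))
        = endHom E' (φ (ι q)) e' at this
      rw [hχ, hφ] at this
      exact this.symm
    have hproj : ∀ x : Poly K X,
        orbitMap E' e' (cls R (V.projectionOnto _ h x : V)) = orbitMap E' e' (cls R x) := by
      intro x
      symm
      rw [← sub_eq_zero, ← map_sub, ← map_sub]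
      exact orbitMap_cls_eq_zero E' e' he' (sub_projectionOnto_mem h x)
    -- The factorization sends `p` to `e'` acted on by the class of `p`; `hproj` lets it ignore
    -- projections.
    refine ⟨{ app := fun _ => ModuleCat.ofHom
                (orbitMap E' e' ∘ₗ (cls R).toLinearMap ∘ₗ V.subtype)
              naturality := ?_ }, ?_, ?_⟩
    · intro _ _ b
      apply ModuleCat.hom_ext
      refine LinearMap.ext fun (p : V) => ?_
      obtain ⟨b, rfl⟩ := cls_surjective R b
      change orbitMap E' e' (cls R ((ρ (cls R b)).unop p : V))
        = endHom E' (cls R b) (orbitMap E' e' (cls R (p : Poly K X)))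
      rw [hρ, hproj, map_mul, orbitMap_mul]
    · ext a
      change (ε'.app (OneObj.pt N)).hom (1 : K)
        = orbitMap E' e' (cls R ((1 : K) • V.projectionOnto _ h 1 : V))
      rw [one_smul, hproj, map_one, orbitMap_apply, endHom_one]
      rfl
    · intro α hα
      apply NatTrans.ext
      funext _
      apply ModuleCat.hom_ext
      refine LinearMap.ext fun (p : V) => ?_
      have hαe : (α.app (OneObj.pt (FactorAlgebra R))).hom e = e' := by
        have := congrArg (fun β => ModuleCat.Hom.hom (NatTrans.app β (OneObj.pt N)) (1 : K)) hα
        change e' = (α.app (OneObj.pt (FactorAlgebra R))).hom ((1 : K) • e) at this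
        rw [this, one_smul]
      have := congrArg (fun f => ModuleCat.Hom.hom f e)
        (α.naturality (X := OneObj.pt (FactorAlgebra R)) (Y := OneObj.pt (FactorAlgebra R))
          (cls R (p : Poly K X)))
      change (α.app (OneObj.pt (FactorAlgebra R))).hom ((ρ (cls R (p : Poly K X))).unop e)
        = endHom E' (cls R (p : Poly K X)) ((α.app (OneObj.pt (FactorAlgebra R))).hom e) at this
      rw [← hgen, hαe] at this
      exact this

/-- The universal vector is fixed by `[F q]` because `F q - 1` lies in `J`. -/
theorem action_generator (h : IsCompl V (taggedSpan (kanSystem R F)))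
    {ρ : FactorAlgebra R →ₐ[K] (Module.End K V)ᵐᵒᵖ}
    (hρ : ∀ b p, (ρ (cls R b)).unop p = V.projectionOnto _ h (p * b)) (q : Q) :
    (ρ (cls R (F q))).unop (V.projectionOnto _ h 1) = V.projectionOnto _ h 1 := by
  rw [hρ, projectionOnto_projectionOnto_mul h fun _ hx b => taggedSpan_mul_right _ hx b, one_mul]
  apply projectionOnto_eq_of_sub_mem
  simpa using mul_mem_taggedSpan (S := kanSystem R F) (Set.mem_range_self q) 1

end UniversalProperty

/-! ### Passage to the Gröbner basis and the main theorem -/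

theorem IsGroebnerBasis.taggedSpan_eq {K X : Type u} [Field K]
    {lt : FreeMonoid X → FreeMonoid X → Prop} {S G : TaggedSystem K X}
    (hG : IsGroebnerBasis lt S G) : taggedSpan G = taggedSpan S := by
  ext f
  simpa [TaggedCongr, taggedSpan] using hG.taggedCongr_iff f 0

end KanGroebner

theorem corollary4p3 {K X : Type u} {Q : Type v} [Field K]
    (R : Set (KanGroebner.Poly K X)) (F : Q → KanGroebner.Poly K X)
    (lt : FreeMonoid X → FreeMonoid X → Prop) (hlt : KanGroebner.Admissible lt)
    (G : KanGroebner.TaggedSystem K X)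
    (hG : KanGroebner.IsGroebnerBasis lt (KanGroebner.kanSystem R F) G) :
    -- `E(B) = IRR`, the arrows act through `ρ`, and `e` is the value of `ε_A` at `1`
    ∃ (ρ : KanGroebner.FactorAlgebra R →ₐ[K] (Module.End K (KanGroebner.IRR lt G))ᵐᵒᵖ)
      (e : KanGroebner.IRR lt G),
      -- `E(B)` has the irreducible tagged words as a `K`-basis
      (KanGroebner.IRR lt G = Submodule.span K
        {x | x ∈ KanGroebner.IRR lt G ∧ ∃ m : FreeMonoid X, x = KanGroebner.word K m}) ∧
      -- `E(b)` sends `A|p` to the unique irreducible result of reducing `A|pb`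
      (∀ (p : KanGroebner.IRR lt G) (b g : KanGroebner.Poly K X),
        KanGroebner.IsNormalForm lt G ((p : KanGroebner.Poly K X) * b) g ↔
          g = ((ρ (KanGroebner.cls R b)).unop p : KanGroebner.IRR lt G)) ∧
      -- `ε_A(1)` is the irreducible result of reducing `A|1`, and it is `A|1` unless `E(B) = 0`
      (∀ g : KanGroebner.Poly K X, KanGroebner.IsNormalForm lt G 1 g ↔ g = e) ∧
      (KanGroebner.IRR lt G ≠ ⊥ → (e : KanGroebner.Poly K X) = 1) ∧
      -- `(E, ε)` is the left Kan extension, for every category generated by the arrows `Q`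
      (∀ (N : Type w) [Monoid N] (ι : Q → N) (_ : Submonoid.closure (Set.range ι) = ⊤)
        (χ : N →* (Module.End K K)ᵐᵒᵖ) (_ : ∀ q, χ (ι q) = 1)
        (φ : N →* KanGroebner.FactorAlgebra R) (_ : ∀ q, φ (ι q) = KanGroebner.cls R (F q)),
        KanGroebner.IsKanExtensionWith χ φ ρ e) ∧
      -- and for every `K`-category generated by the arrows `Q`
      (∀ (N : Type w) [Ring N] [Algebra K N] (ι : Q → N) (_ : Algebra.adjoin K (Set.range ι) = ⊤)
        (χ : N →ₐ[K] (Module.End K K)ᵐᵒᵖ) (_ : ∀ q, χ (ι q) = 1)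
        (φ : N →ₐ[K] KanGroebner.FactorAlgebra R) (_ : ∀ q, φ (ι q) = KanGroebner.cls R (F q)),
        KanGroebner.IsKanExtensionWith (χ : N →* (Module.End K K)ᵐᵒᵖ)
          (φ : N →* KanGroebner.FactorAlgebra R) ρ e) := by
  have hGS := hG.taggedSpan_eq
  have h : IsCompl (KanGroebner.IRR lt G)
      (KanGroebner.taggedSpan (KanGroebner.kanSystem R F)) :=
    hGS ▸ KanGroebner.isCompl_IRR_taggedSpan hlt hG.tagged_complete
  have hnf : ∀ f g : KanGroebner.Poly K X, KanGroebner.IsNormalForm lt G f g ↔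
      g = ((KanGroebner.IRR lt G).projectionOnto _ h f : KanGroebner.IRR lt G) := by
    intro f g
    rw [KanGroebner.isNormalForm_iff hlt hG.tagged_complete, hGS]
    constructor
    · rintro ⟨hg, hfg⟩
      rw [KanGroebner.projectionOnto_eq_of_sub_mem h hfg,
        Submodule.projectionOnto_apply_of_mem_left h hg]
    · rintro rfl
      exact ⟨Subtype.property _, KanGroebner.sub_projectionOnto_mem h f⟩
  obtain ⟨ρ, hρ⟩ := KanGroebner.exists_factorAlgebra_action h
  refine ⟨ρ, (KanGroebner.IRR lt G).projectionOnto _ h 1, KanGroebner.IRR_eq_span lt G,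
    fun p b g => by rw [hnf, hρ], fun g => hnf 1 g, fun hne => ?_, ?_, ?_⟩
  · rcases KanGroebner.one_mem_IRR_or_one_mem_taggedSpan hlt G with h1 | h1
    · exact congrArg Subtype.val (Submodule.projectionOnto_apply_of_mem_left h h1)
    · refine (hne ?_).elim
      rw [hGS] at h1
      -- A right ideal containing `1` is everything, so its complement `IRR` is zero.
      have htop : KanGroebner.taggedSpan (KanGroebner.kanSystem R F) = ⊤ :=
        eq_top_iff.2 fun x _ => by
          simpa using KanGroebner.taggedSpan_mul_right _ h1 x
      exact disjoint_top.1 (htop ▸ h.disjoint)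
  · intro N _ ι hι χ hχ φ hφ
    refine KanGroebner.isKanExtensionWith_of_action h hρ hχ hφ fun n => ?_
    induction (hι ▸ Submonoid.mem_top n : n ∈ Submonoid.closure (Set.range ι)) using
      Submonoid.closure_induction with
    | mem x hx =>
      obtain ⟨q, rfl⟩ := hx
      rw [hφ, hχ, KanGroebner.action_generator h hρ]
      simp
    | one => simp
    | mul x y _ _ hx hy => exact KanGroebner.action_eq_smul_mul hx hy
  · intro N _ _ ι hι χ hχ φ hφ
    refine KanGroebner.isKanExtensionWith_of_action h hρ hχ hφ fun n => ?_
    -- The arrows acting on `e` through `χ` contain `Q` and form a subalgebra, hence are all of `N`.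
    induction (hι ▸ Algebra.mem_top : n ∈ Algebra.adjoin K (Set.range ι)) using
      Algebra.adjoin_induction with
    | mem x hx =>
      obtain ⟨q, rfl⟩ := hx
      simp [hφ, hχ, KanGroebner.action_generator h hρ]
    | algebraMap k =>
      simp [Algebra.algebraMap_eq_smul_one]
    | add x y _ _ hx hy =>
      simp only [MonoidHom.coe_coe] at hx hy ⊢
      simp [hx, hy, add_smul]
    | mul x y _ _ hx hy => exact KanGroebner.action_eq_smul_mul hx hy
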